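/- An instance of card-V-RAP consists of a finite bipartite graph $G=(U\,\dot\cup\,W,E)$ and a nonempty set $\mathcal F\subseteq W$ of vulnerable nodes. A feasible solution is a set $X\subseteq W$ such that for every $f\in\mathcal F$ the graph $G[U\cup X]-\{f\}$ contains a $U$-perfect matching (a matching covering every node of $U$); the goal is to minimize $|X|$. The instance need not be uniform, i.e. $\mathcal F\neq W$ is allowed. Consider the following algorithm for a feasible instance. 1. Let $M$ be any $U$-perfect matching in $G$, and let $W^M\subseteq W$ be the set of nodes of $W$ covered by $M$. For each $w\in W\setminus W^M$ let $R_w$ be the set of all $u\in U$ for which $G[U\cup W^M\cup\{w\}]$ contains an $M$-alternating $u$-$w$-path. 2. Set $X:=W^M$ and let $U_{\mathcal F}$ be the set of all $u\in U$ that $M$ matches to a node of $\mathcal F$ (so $U_{\mathcal F}=U$ for uniform instances). 3. While $U_{\mathcal F}\neq\emptyset$: choose $\bar w\in W\setminus X$ maximizing $|R_{\bar w}\cap U_{\mathcal F}|$ (ties broken arbitrarily), replace $U_{\mathcal F}$ by $U_{\mathcal F}\setminus R_{\bar w}$, and replace $X$ by $X\cup\{\bar w\}$. 4. Return $X$. Call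 an iteration of the loop productive if it decreases $|U_{\mathcal F}|$ by at least two, and let $p$ be the total decrease of $|U_{\mathcal F}|$ over all productive iterations. **Corollary.** For every feasible instance of card-V-RAP with $\mathcal F\ne\emptyset$, uniform or not, the algorithm can be carried out (a $U$-perfect matching $M$ exists and, for every choice of $M$ and of the nodes $\bar w$, a node $\bar w$ can be chosen whenever the loop is entered) and the loop stops after at most $|U|$ iterations. Every set $X$ that it can return is a feasible solution with $$|X|\le 2|U|-\frac p2,$$ and every optimal solution $\mathrm{OPT}$ satisfies $|\mathrm{OPT}|\ge|U|$ and $$|X|\le 2\,|\mathrm{OPT}|.$$ That is, the algorithm has approximation ratio $2$. -/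

import Mathlib

/-- An instance of card-V-RAP (node-robust assignment with unit costs): a bipartite graph whose
finite sides are the jobs `U` and the machines `W`, and a set of vulnerable machines; every
vulnerable machine `f` is the failure scenario in which exactly `f` is removed. -/
structure CardVRAP (V : Type*) where
  /-- the graph `G` -/
  graph : SimpleGraph V
  /-- the set `U` of jobs -/
  jobs : Finset V
  /-- the set `W` of machines -/
  machines : Finset V
  /-- `U` and `W` are disjoint and every edge of `G` joins a job to a machine -/
  bipartite : graph.IsBipartiteWith (jobs : Set V) (machines : Set V)
  /-- the set of vulnerable machines -/
  vulnerable : Finset V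
  vulnerable_subset : vulnerable ⊆ machines

namespace CardVRAP

variable {V : Type*} [DecidableEq V] (I : CardVRAP V)

/-- `M` is a `U`-perfect matching: a matching that covers every job. -/
def IsJobPerfectMatching (M : I.graph.Subgraph) : Prop :=
  M.IsMatching ∧ (I.jobs : Set V) ⊆ M.verts

/-- The graph `G[U ∪ X] - {f}`. -/
def scenarioGraph (X : Finset V) (f : V) : I.graph.Subgraph :=
  ((⊤ : I.graph.Subgraph).induce ((I.jobs : Set V) ∪ (X : Set V))).deleteVerts {f}

/-- Feasible (node-robust) solutions: sets `X` of machines such that for every vulnerable `f`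
the graph `G[U ∪ X] - {f}` contains a `U`-perfect matching. -/
def IsRobust (X : Finset V) : Prop :=
  X ⊆ I.machines ∧ ∀ f ∈ I.vulnerable,
    ∃ M : I.graph.Subgraph, I.IsJobPerfectMatching M ∧ M ≤ I.scenarioGraph X f

/-- The instance is feasible: it has a node-robust solution. -/
def IsFeasible : Prop := ∃ X : Finset V, I.IsRobust X

/-- An optimal solution: a node-robust solution of minimum cardinality. -/
def IsOptimal (X : Finset V) : Prop :=
  I.IsRobust X ∧ ∀ Y : Finset V, I.IsRobust Y → X.card ≤ Y.card

/-- `W^M`: the machines covered by `M`. -/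
noncomputable def matchedMachines (M : I.graph.Subgraph) : Finset V :=
  open scoped Classical in I.machines.filter (fun w => w ∈ M.verts)

/-- The critical jobs: those matched by `M` to a vulnerable machine. In the uniform case (all
machines vulnerable) these are all the jobs. -/
noncomputable def criticalJobs (M : I.graph.Subgraph) : Finset V :=
  open scoped Classical in I.jobs.filter (fun u => ∃ f ∈ I.vulnerable, M.Adj u f)

/-- `p` is an `M`-alternating path: a path on which, of any two consecutive edges, exactly one
belongs to `M`. -/
def IsAlternatingPath (M : I.graph.Subgraph) {u w : V} (p : I.graph.Walk u w) : Prop :=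
  p.IsPath ∧ p.edges.IsChain (fun e e' => e ∈ M.edgeSet ↔ e' ∉ M.edgeSet)

/-- `R_w`: the jobs `u` for which `G[U ∪ W^M ∪ {w}]` contains an `M`-alternating `u`-`w`-path. -/
noncomputable def cover (M : I.graph.Subgraph) (w : V) : Finset V :=
  open scoped Classical in I.jobs.filter (fun u => ∃ p : I.graph.Walk u w,
    I.IsAlternatingPath M p ∧ ∀ v ∈ p.support, v ∈ I.jobs ∪ I.matchedMachines M ∪ {w})

/-- `w` is an admissible choice in one iteration: with current machine set `X` and current set
`C` of uncovered critical jobs, `w` maximizes `|R_w ∩ C|` over `W \ X`; ties are broken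
arbitrarily. -/
def IsGreedyChoice (M : I.graph.Subgraph) (X C : Finset V) (w : V) : Prop :=
  w ∈ I.machines \ X ∧
    ∀ w' ∈ I.machines \ X, (I.cover M w' ∩ C).card ≤ (I.cover M w ∩ C).card

/-- The executions of the greedy algorithm started from the `U`-perfect matching `M`.
`Run M k p X C` says that some execution is, after `k` iterations of the while loop, at the
machine set `X` with set `C` of uncovered critical jobs, and that its productive iterations so
far (those that cover at least two jobs of the current `C`) have covered `p` jobs in total.
The loop is executed while `C` is nonempty, so the execution halts, with output `X`, when `C`
is empty. The counters `k` and `p` only record the execution. -/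
inductive Run (M : I.graph.Subgraph) : ℕ → ℕ → Finset V → Finset V → Prop
  | init : Run M 0 0 (I.matchedMachines M) (I.criticalJobs M)
  | step {k p : ℕ} {X C : Finset V} {w : V} :
      Run M k p X C → C.Nonempty → I.IsGreedyChoice M X C w →
      Run M (k + 1)
        (p + if 2 ≤ (I.cover M w ∩ C).card then (I.cover M w ∩ C).card else 0)
        (insert w X) (C \ I.cover M w)

end CardVRAP

/-! View `M` as an injection `m` from jobs to machines. Switching `M` along an alternating path from
`u` to an unmatched `w` frees `m u`, so a set containing `W^M` is robust once each critical job lies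
in some `R_w` with `w` added (`isRobust_of_cover`). Conversely, feasibility puts each critical job
in some such `R_w` (`exists_mem_cover`, by a Hall-type count). For an uncovered job this `w` is not
yet in `X`, so the loop never gets stuck and each iteration covers at least one job. An iteration
covering `c` jobs changes `2k + p + 2|C|` by `0` if `c = 1` and by `2 - c ≤ 0` otherwise. Hence `2k
+ p ≤ 2|U|` throughout, and `|X| = |U| + k` gives the bound. Every robust set contains the image of
an injection of `U`, so `|OPT| ≥ |U|`. -/

namespace CardVRAP

/-! ### Matchings as injections -/

section Matchings

variable {V : Type*} (I : CardVRAP V)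

/-- `m` sends the jobs injectively to adjacent machines. -/
structure IsAssignment (m : V → V) : Prop where
  injOn : Set.InjOn m (I.jobs : Set V)
  adj : ∀ u ∈ I.jobs, I.graph.Adj u (m u)

variable {I}

theorem machine_of_adj {u w : V} (hu : u ∈ I.jobs) (h : I.graph.Adj u w) : w ∈ I.machines :=
  Finset.mem_coe.1 (I.bipartite.mem_of_mem_adj (Finset.mem_coe.2 hu) h)

theorem job_of_adj {u w : V} (hw : w ∈ I.machines) (h : I.graph.Adj u w) : u ∈ I.jobs :=
  Finset.mem_coe.1 (I.bipartite.symm.mem_of_mem_adj (Finset.mem_coe.2 hw) h.symm)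

theorem notMem_machines_of_mem_jobs {v : V} (hu : v ∈ I.jobs) : v ∉ I.machines := fun hw =>
  Set.disjoint_left.1 I.bipartite.disjoint (Finset.mem_coe.2 hu) (Finset.mem_coe.2 hw)

theorem IsAssignment.mem_machines {m : V → V} (hm : I.IsAssignment m) {u : V}
    (hu : u ∈ I.jobs) : m u ∈ I.machines :=
  machine_of_adj hu (hm.adj u hu)

theorem IsAssignment.card_jobs_le {m : V → V} (hm : I.IsAssignment m) {X : Finset V}
    (hX : ∀ u ∈ I.jobs, m u ∈ X) : I.jobs.card ≤ X.card :=
  Finset.card_le_card_of_injOn m hX hm.injOn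

/-- A job-perfect matching is the graph of an assignment on the jobs. -/
theorem IsJobPerfectMatching.exists_assignment [DecidableEq V] {M : I.graph.Subgraph}
    (hM : I.IsJobPerfectMatching M) :
    ∃ m, I.IsAssignment m ∧ ∀ u ∈ I.jobs, ∀ w, M.Adj u w ↔ w = m u := by
  have h : ∀ u : V, ∃ w, u ∈ I.jobs → ∀ w', M.Adj u w' ↔ w' = w := by
    intro u
    by_cases hu : u ∈ I.jobs
    · obtain ⟨w, hw, huniq⟩ := hM.1 (hM.2 (Finset.mem_coe.2 hu))
      exact ⟨w, fun _ w' => ⟨fun h => huniq w' h, fun h => h ▸ hw⟩⟩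
    · exact ⟨u, fun h => absurd h hu⟩
  choose m hm using h
  refine ⟨m, ⟨fun u hu v hv huv => ?_, fun u hu => ((hm u hu _).2 rfl).adj_sub⟩, hm⟩
  have h₁ : M.Adj u (m u) := (hm u hu _).2 rfl
  have h₂ : M.Adj v (m u) := (hm v hv _).2 huv
  exact hM.1.eq_of_adj_right h₁ h₂

theorem mem_matchedMachines_iff {M : I.graph.Subgraph} (hM : I.IsJobPerfectMatching M)
    {m : V → V} (hm : I.IsAssignment m) (hMm : ∀ u ∈ I.jobs, ∀ w, M.Adj u w ↔ w = m u) {w : V} :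
    w ∈ I.matchedMachines M ↔ ∃ u ∈ I.jobs, m u = w := by
  classical
  simp only [matchedMachines, Finset.mem_filter]
  constructor
  · rintro ⟨hw, hv⟩
    obtain ⟨u, hu, -⟩ := hM.1 hv
    have huj := job_of_adj hw hu.adj_sub.symm
    exact ⟨u, huj, ((hMm u huj w).1 hu.symm).symm⟩
  · rintro ⟨u, hu, rfl⟩
    exact ⟨hm.mem_machines hu, M.edge_vert ((hMm u hu _).2 rfl).symm⟩

theorem matchedMachines_eq_image [DecidableEq V] {M : I.graph.Subgraph}
    (hM : I.IsJobPerfectMatching M) {m : V → V} (hm : I.IsAssignment m)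
    (hMm : ∀ u ∈ I.jobs, ∀ w, M.Adj u w ↔ w = m u) :
    I.matchedMachines M = I.jobs.image m := by
  ext w
  rw [mem_matchedMachines_iff hM hm hMm, Finset.mem_image]

/-- The job-perfect matchings of a scenario graph are the assignments into `X \ {f}`. -/
theorem exists_matching_scenarioGraph_iff [DecidableEq V] {X : Finset V} {f : V}
    (hf : f ∈ I.machines) :
    (∃ M : I.graph.Subgraph, I.IsJobPerfectMatching M ∧ M ≤ I.scenarioGraph X f) ↔
      ∃ g, I.IsAssignment g ∧ ∀ u ∈ I.jobs, g u ∈ X ∧ g u ≠ f := by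
  constructor
  · rintro ⟨M, hM, hle⟩
    obtain ⟨g, hg, hMg⟩ := hM.exists_assignment
    refine ⟨g, hg, fun u hu => ?_⟩
    have hv := hle.1 (M.edge_vert ((hMg u hu _).2 rfl).symm)
    simp only [scenarioGraph, SimpleGraph.Subgraph.induce_verts, Set.mem_sdiff, Set.mem_union,
      Finset.mem_coe, Set.mem_singleton_iff] at hv
    exact ⟨hv.1.resolve_left fun h => notMem_machines_of_mem_jobs h (hg.mem_machines hu), hv.2⟩
  · rintro ⟨g, hg, hgX⟩
    have hne : ∀ {u v}, u ∈ I.jobs → v ∈ I.jobs → u ≠ g v := fun hu hv h =>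
      notMem_machines_of_mem_jobs hu (h ▸ hg.mem_machines hv)
    let M : I.graph.Subgraph :=
      { verts := {v | v ∈ I.jobs ∨ ∃ u ∈ I.jobs, g u = v}
        Adj := fun a b => (a ∈ I.jobs ∧ g a = b) ∨ (b ∈ I.jobs ∧ g b = a)
        adj_sub := by
          rintro a b (⟨ha, rfl⟩ | ⟨hb, rfl⟩)
          · exact hg.adj a ha
          · exact (hg.adj b hb).symm
        edge_vert := by
          rintro a b (⟨ha, -⟩ | ⟨hb, h⟩)
          · exact Or.inl ha
          · exact Or.inr ⟨b, hb, h⟩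
        symm := ⟨fun a b h => h.symm⟩ }
    have hverts : ∀ v ∈ M.verts,
        v ∈ ((I.jobs : Set V) ∪ (X : Set V)) \ {f} := by
      rintro v (hv | ⟨u, hu, rfl⟩)
      · exact ⟨Or.inl hv, fun h => notMem_machines_of_mem_jobs hv (h ▸ hf)⟩
      · exact ⟨Or.inr (hgX u hu).1, (hgX u hu).2⟩
    refine ⟨M, ⟨?_, fun v hv => Or.inl hv⟩, hverts, ?_⟩
    · rintro v (hv | ⟨u, hu, rfl⟩)
      · refine ⟨g v, Or.inl ⟨hv, rfl⟩, ?_⟩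
        rintro w (⟨-, h⟩ | ⟨hw, h⟩)
        · exact h.symm
        · exact absurd h.symm (hne hv hw)
      · refine ⟨u, Or.inr ⟨hu, rfl⟩, ?_⟩
        rintro w (⟨h, -⟩ | ⟨hw, h⟩)
        · exact absurd rfl (hne h hu)
        · exact hg.injOn hw hu h
    · intro a b hab
      have ha := hverts a (M.edge_vert hab)
      have hb := hverts b (M.edge_vert hab.symm)
      simp only [scenarioGraph, SimpleGraph.Subgraph.induce_adj, SimpleGraph.Subgraph.induce_verts,
        SimpleGraph.Subgraph.top_adj]
      exact ⟨ha, hb, ha.1, hb.1, hab.adj_sub⟩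

theorem card_criticalJobs_le (M : I.graph.Subgraph) :
    (I.criticalJobs M).card ≤ I.jobs.card :=
  Finset.card_le_card fun _ h => by
    classical exact (Finset.mem_filter.1 h).1

end Matchings

/-! ### Alternating paths and switching -/

section AlternatingPaths

variable {V : Type*} (I : CardVRAP V)

/-- `I.AltPath m w u l`: there is an alternating path for the assignment `m` from the job `u` to
the machine `w` that starts with an edge outside `m` and visits the jobs `l`, in this order. -/
inductive AltPath (m : V → V) (w : V) : V → List V → Prop
  | single {u : V} : u ∈ I.jobs → I.graph.Adj u w → AltPath m w u [u]
  | cons {u v : V} {l : List V} : u ∈ I.jobs → I.graph.Adj u (m v) → u ∉ l →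
      AltPath m w v l → AltPath m w u (u :: l)

variable {I} {m : V → V} {w u : V} {l : List V}

theorem AltPath.mem (h : I.AltPath m w u l) : u ∈ l := by
  cases h <;> simp

theorem AltPath.mem_jobs (h : I.AltPath m w u l) : ∀ v ∈ l, v ∈ I.jobs := by
  induction h with
  | single hu _ => simpa using hu
  | cons hu _ _ _ ih => simpa using ⟨hu, ih⟩

theorem AltPath.exists_suffix (h : I.AltPath m w u l) :
    ∀ v ∈ l, ∃ l', I.AltPath m w v l' := by
  induction h with
  | @single u hu ha =>
    intro v hv
    obtain rfl := List.mem_singleton.1 hv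
    exact ⟨_, .single hu ha⟩
  | @cons u v l hu ha hl hp ih =>
    intro x hx
    rcases List.mem_cons.1 hx with rfl | hx
    · exact ⟨_, .cons hu ha hl hp⟩
    · exact ih x hx

/-- Switching the assignment `m` along an alternating path from `u` to `w` frees `m u`. -/
theorem AltPath.exists_switch [DecidableEq V] (hm : I.IsAssignment m) (hw : ∀ v ∈ I.jobs, m v ≠ w)
    (h : I.AltPath m w u l) :
    ∃ g, I.IsAssignment g ∧ (∀ v ∈ I.jobs, g v ≠ m u) ∧
      (∀ v ∈ I.jobs, g v = w ∨ ∃ x ∈ I.jobs, m x = g v) ∧ ∀ v ∉ l, g v = m v := by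
  -- Moving one job to a free neighbour preserves injectivity.
  have update : ∀ (g : V → V) (a y : V), I.IsAssignment g → a ∈ I.jobs → I.graph.Adj a y →
      (∀ v ∈ I.jobs, g v ≠ y) → I.IsAssignment (Function.update g a y) := by
    intro g a y hg ha hy hfree
    refine ⟨fun b hb c hc hbc => ?_, fun b hb => ?_⟩
    · by_cases hba : b = a <;> by_cases hca : c = a
      · rw [hba, hca]
      · subst hba
        rw [Function.update_self, Function.update_of_ne hca] at hbc
        exact absurd hbc.symm (hfree c hc)
      · subst hca
        rw [Function.update_self, Function.update_of_ne hba] at hbc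
        exact absurd hbc (hfree b hb)
      · rw [Function.update_of_ne hba, Function.update_of_ne hca] at hbc
        exact hg.injOn hb hc hbc
    · by_cases hba : b = a
      · subst hba; rwa [Function.update_self]
      · rw [Function.update_of_ne hba]; exact hg.adj b hb
  induction h with
  | @single u hu ha =>
    refine ⟨Function.update m u w, update m u w hm hu ha hw, fun v hv => ?_, fun v hv => ?_,
      fun v hv => Function.update_of_ne (by simpa using hv) _ _⟩
    · by_cases hvu : v = u
      · subst hvu; rw [Function.update_self]; exact (hw v hv).symm
      · rw [Function.update_of_ne hvu]; exact fun h => hvu (hm.injOn hv hu h)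
    · by_cases hvu : v = u
      · subst hvu; exact Or.inl (Function.update_self ..)
      · rw [Function.update_of_ne hvu]; exact Or.inr ⟨v, hv, rfl⟩
  | @cons u x l hu ha hl hp ih =>
    obtain ⟨g, hg, hfree, hrange, heq⟩ := ih
    have hxj := hp.mem_jobs x hp.mem
    have hux : x ≠ u := fun h => hl (h ▸ hp.mem)
    refine ⟨Function.update g u (m x), update g u _ hg hu ha hfree, fun v hv => ?_,
      fun v hv => ?_, fun v hv => ?_⟩
    · by_cases hvu : v = u
      · subst hvu; rw [Function.update_self]; exact fun h => hux (hm.injOn hxj hv h)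
      -- Switching the suffix left `u` at `m u`, so no other job sits there.
      · rw [Function.update_of_ne hvu, ← heq u hl]; exact fun h => hvu (hg.injOn hv hu h)
    · by_cases hvu : v = u
      · subst hvu; rw [Function.update_self]; exact Or.inr ⟨x, hxj, rfl⟩
      · rw [Function.update_of_ne hvu]; exact hrange v hv
    · rw [List.mem_cons, not_or] at hv
      rw [Function.update_of_ne hv.1]; exact heq v hv.2

/-- If some assignment avoids `m u₀`, then `u₀` is the start of an alternating path to a machine
that `m` does not use. -/
theorem exists_altPath_of_avoiding [DecidableEq V] (hm : I.IsAssignment m)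
    {n : V → V} (hn : I.IsAssignment n)
    {u₀ : V} (hu₀ : u₀ ∈ I.jobs) (havoid : ∀ u ∈ I.jobs, n u ≠ m u₀) :
    ∃ w ∈ I.machines, (∀ v ∈ I.jobs, m v ≠ w) ∧ ∃ l, I.AltPath m w u₀ l := by
  classical
  by_contra hbad
  -- The jobs with no path to a free machine. A path from the `m`-partner of `n u` would extend to
  -- `u`, so `n` maps `B` into `m(B)`; equal cardinalities then force `m u₀ ∈ n(B)`.
  set B := I.jobs.filter fun u =>
    ¬ ∃ w ∈ I.machines, (∀ v ∈ I.jobs, m v ≠ w) ∧ ∃ l, I.AltPath m w u l with hB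
  have hBj : ∀ u ∈ B, u ∈ I.jobs := fun u hu => (Finset.mem_filter.1 hu).1
  have hu₀B : u₀ ∈ B := Finset.mem_filter.2 ⟨hu₀, hbad⟩
  have hmaps : B.image n ⊆ B.image m := by
    intro y hy
    obtain ⟨u, hu, rfl⟩ := Finset.mem_image.1 hy
    obtain ⟨huj, hub⟩ := Finset.mem_filter.1 hu
    by_cases hfree : ∀ v ∈ I.jobs, m v ≠ n u
    · exact absurd ⟨n u, hn.mem_machines huj, hfree, _, .single huj (hn.adj u huj)⟩ hub
    push Not at hfree
    obtain ⟨v, hvj, hv⟩ := hfree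
    refine Finset.mem_image.2 ⟨v, Finset.mem_filter.2 ⟨hvj, ?_⟩, hv⟩
    rintro ⟨w, hw, hwfree, l, hl⟩
    -- If prepending `u` would repeat it, the suffix from `u` already serves.
    by_cases hul : u ∈ l
    · exact hub ⟨w, hw, hwfree, hl.exists_suffix u hul⟩
    · exact hub ⟨w, hw, hwfree, _, .cons huj (hv ▸ hn.adj u huj) hul hl⟩
  have hcard : (B.image m).card ≤ (B.image n).card := by
    rw [Finset.card_image_of_injOn (hn.injOn.mono hBj), Finset.card_image_of_injOn
      (hm.injOn.mono hBj)]
  have h := Finset.eq_of_subset_of_card_le hmaps hcard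
  have : m u₀ ∈ B.image n := h ▸ Finset.mem_image_of_mem m hu₀B
  obtain ⟨v, hv, hvn⟩ := Finset.mem_image.1 this
  exact havoid v (hBj v hv) hvn

/-- The last two conclusions drive the induction: a first edge outside `M` keeps alternation when a
matching edge is prepended, and not visiting `m u` keeps the walk a path. -/
theorem AltPath.exists_walk {M : I.graph.Subgraph} (hm : I.IsAssignment m)
    (hMm : ∀ u ∈ I.jobs, ∀ w, M.Adj u w ↔ w = m u) (hwm : w ∈ I.machines)
    (hw : ∀ v ∈ I.jobs, m v ≠ w) (h : I.AltPath m w u l) :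
    ∃ p : I.graph.Walk u w, I.IsAlternatingPath M p ∧ (∀ e ∈ p.edges.head?, e ∉ M.edgeSet) ∧
      ∀ v ∈ p.support, v ∈ l ∨ (∃ x ∈ l, x ≠ u ∧ m x = v) ∨ v = w := by
  induction h with
  | @single u hu ha =>
    refine ⟨.cons ha .nil, ⟨?_, ?_⟩, ?_, ?_⟩
    · simpa using ha.ne
    · simp
    · simp only [SimpleGraph.Walk.edges_cons, List.head?_cons, Option.mem_def, Option.some.injEq]
      rintro e rfl h
      exact hw u hu ((hMm u hu w).1 h).symm
    · simp +contextual
  | @cons u x l hu ha hl hp ih =>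
    obtain ⟨p, ⟨hpath, hchain⟩, hhead, hsupp⟩ := ih
    have hxj := hp.mem_jobs x hp.mem
    have hux : x ≠ u := fun h => hl (h ▸ hp.mem)
    have hMx : s(m x, x) ∈ M.edgeSet := ((hMm x hxj _).2 rfl).symm
    have hMu : s(u, m x) ∉ M.edgeSet := fun h =>
      hux (hm.injOn hxj hu ((hMm u hu _).1 h))
    refine ⟨.cons ha (.cons (hm.adj x hxj).symm p), ⟨?_, ?_⟩, ?_, ?_⟩
    · rw [SimpleGraph.Walk.cons_isPath_iff, SimpleGraph.Walk.cons_isPath_iff]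
      refine ⟨⟨hpath, fun h => ?_⟩, fun h => ?_⟩
      · rcases hsupp _ h with h | ⟨y, hy, hyx, hxy⟩ | h
        · exact notMem_machines_of_mem_jobs (hp.mem_jobs _ h) (hm.mem_machines hxj)
        · exact hyx (hm.injOn (hp.mem_jobs y hy) hxj hxy)
        · exact hw x hxj h
      · rw [SimpleGraph.Walk.support_cons, List.mem_cons] at h
        rcases h with h | h
        · exact ha.ne h
        rcases hsupp _ h with h | ⟨y, hy, -, hxy⟩ | h
        · exact hl h
        · exact notMem_machines_of_mem_jobs hu (hxy ▸ hm.mem_machines (hp.mem_jobs y hy))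
        · exact notMem_machines_of_mem_jobs hu (h ▸ hwm)
    · simp only [SimpleGraph.Walk.edges_cons, List.isChain_cons, List.head?_cons, Option.mem_def,
        Option.some.injEq, forall_eq']
      exact ⟨iff_of_false hMu (not_not.2 hMx), fun e he => iff_of_true hMx (hhead e he), hchain⟩
    · simpa using hMu
    · intro v hv
      simp only [SimpleGraph.Walk.support_cons, List.mem_cons] at hv
      rcases hv with rfl | rfl | hv
      · exact Or.inl (by simp)
      · exact Or.inr (Or.inl ⟨x, List.mem_cons_of_mem _ hp.mem, hux, rfl⟩)
      · rcases hsupp v hv with h | ⟨y, hy, -, hxy⟩ | h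
        · exact Or.inl (List.mem_cons_of_mem _ h)
        · exact Or.inr (Or.inl ⟨y, List.mem_cons_of_mem _ hy, fun h => hl (h ▸ hy), hxy⟩)
        · exact Or.inr (Or.inr h)

/-- The last edge is outside `M` because `w` is free; peeling two edges at a time, by bipartiteness,
carries this to the first edge. -/
theorem exists_altPath_of_walk {M : I.graph.Subgraph} (hm : I.IsAssignment m)
    (hMm : ∀ u ∈ I.jobs, ∀ w, M.Adj u w ↔ w = m u) {u w : V} (hwm : w ∈ I.machines)
    (hw : ∀ v ∈ I.jobs, m v ≠ w) (hu : u ∈ I.jobs) (p : I.graph.Walk u w)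
    (hp : I.IsAlternatingPath M p) :
    (∃ e ∈ p.edges.head?, e ∉ M.edgeSet) ∧ ∃ l, I.AltPath m w u l ∧ ∀ v ∈ l, v ∈ p.support := by
  match p with
  | .nil => exact absurd hwm (notMem_machines_of_mem_jobs hu)
  | .cons h .nil =>
    refine ⟨⟨_, rfl, fun hM => hw u hu ((hMm u hu w).1 hM).symm⟩, _, .single hu h, by simp⟩
  | .cons (v := v) h (.cons (v := x) h' q) =>
    obtain ⟨hpath, hchain⟩ := hp
    rw [SimpleGraph.Walk.cons_isPath_iff, SimpleGraph.Walk.cons_isPath_iff] at hpath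
    simp only [SimpleGraph.Walk.edges_cons, List.isChain_cons, List.head?_cons, Option.mem_def,
      Option.some.injEq, forall_eq'] at hchain
    have hxj : x ∈ I.jobs := job_of_adj (machine_of_adj hu h) h'.symm
    obtain ⟨⟨e, he, heM⟩, l, hl, hls⟩ := exists_altPath_of_walk hm hMm hwm hw hxj q
      ⟨hpath.1.1, hchain.2.2⟩
    have hvx : s(v, x) ∈ M.edgeSet := (hchain.2.1 e he).2 heM
    have huv : s(u, v) ∉ M.edgeSet := fun h => hchain.1.1 h hvx
    have hv : v = m x := (hMm x hxj v).1 (SimpleGraph.Subgraph.mem_edgeSet.1 hvx).symm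
    refine ⟨⟨_, rfl, huv⟩, u :: l, .cons hu (hv ▸ h) (fun hul => hpath.2 ?_) hl, ?_⟩
    · simp [hls u hul]
    · intro y hy
      rcases List.mem_cons.1 hy with rfl | hy
      · simp
      · simp [hls y hy]
termination_by p.length

/-- The restriction to `G[U ∪ W^M ∪ {w}]` costs nothing: before `w`, an `AltPath` meets only matched
machines. -/
theorem mem_cover_iff [DecidableEq V] {M : I.graph.Subgraph}
    (hM : I.IsJobPerfectMatching M) (hm : I.IsAssignment m)
    (hMm : ∀ u ∈ I.jobs, ∀ w, M.Adj u w ↔ w = m u) (hwm : w ∈ I.machines)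
    (hw : ∀ v ∈ I.jobs, m v ≠ w) :
    u ∈ I.cover M w ↔ ∃ l, I.AltPath m w u l := by
  classical
  have hsupp : ∀ v, v ∈ I.jobs ∪ I.matchedMachines M ∪ {w} ↔
      v ∈ I.jobs ∨ (∃ x ∈ I.jobs, m x = v) ∨ v = w := by
    intro v
    rw [Finset.mem_union, Finset.mem_union, mem_matchedMachines_iff hM hm hMm,
      Finset.mem_singleton, or_assoc]
  simp only [cover, Finset.mem_filter, hsupp]
  constructor
  · rintro ⟨hu, p, hp, -⟩
    obtain ⟨-, l, hl, -⟩ := exists_altPath_of_walk hm hMm hwm hw hu p hp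
    exact ⟨l, hl⟩
  · rintro ⟨l, hl⟩
    obtain ⟨p, hp, -, hs⟩ := hl.exists_walk hm hMm hwm hw
    refine ⟨hl.mem_jobs u hl.mem, p, hp, fun v hv => ?_⟩
    rcases hs v hv with h | ⟨x, hx, -, h⟩ | h
    · exact Or.inl (hl.mem_jobs v h)
    · exact Or.inr (Or.inl ⟨x, hl.mem_jobs x hx, h⟩)
    · exact Or.inr (Or.inr h)

end AlternatingPaths

/-! ### Robustness and the greedy invariants -/

section Greedy

variable {V : Type*} [DecidableEq V] {I : CardVRAP V}

theorem IsRobust.exists_assignment {X : Finset V} (hX : I.IsRobust X) {f : V}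
    (hf : f ∈ I.vulnerable) :
    ∃ g, I.IsAssignment g ∧ ∀ u ∈ I.jobs, g u ∈ X ∧ g u ≠ f :=
  (exists_matching_scenarioGraph_iff (I.vulnerable_subset hf)).1 (hX.2 f hf)

theorem IsRobust.card_jobs_le {X : Finset V} (hX : I.IsRobust X) (hvul : I.vulnerable.Nonempty) :
    I.jobs.card ≤ X.card := by
  obtain ⟨f, hf⟩ := hvul
  obtain ⟨g, hg, hgX⟩ := hX.exists_assignment hf
  exact hg.card_jobs_le fun u hu => (hgX u hu).1

/-- In a feasible instance every critical job is covered by some unmatched machine. -/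
theorem exists_mem_cover {M : I.graph.Subgraph} (hfeas : I.IsFeasible)
    (hM : I.IsJobPerfectMatching M) {u : V} (hu : u ∈ I.criticalJobs M) :
    ∃ w ∈ I.machines \ I.matchedMachines M, u ∈ I.cover M w := by
  classical
  obtain ⟨m, hm, hMm⟩ := hM.exists_assignment
  obtain ⟨huj, f, hf, huf⟩ := Finset.mem_filter.1 hu
  obtain rfl := (hMm u huj f).1 huf
  obtain ⟨X, hX⟩ := hfeas
  obtain ⟨n, hn, hnX⟩ := hX.exists_assignment hf
  obtain ⟨w, hwm, hw, hl⟩ := exists_altPath_of_avoiding hm hn huj fun v hv => (hnX v hv).2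
  refine ⟨w, Finset.mem_sdiff.2 ⟨hwm, fun h => ?_⟩, (mem_cover_iff hM hm hMm hwm hw).2 hl⟩
  obtain ⟨v, hv, hvw⟩ := (mem_matchedMachines_iff hM hm hMm).1 h
  exact hw v hv hvw

/-- A set of machines containing the matched ones is robust if it covers every critical job. -/
theorem isRobust_of_cover {M : I.graph.Subgraph} (hM : I.IsJobPerfectMatching M) {X : Finset V}
    (hX : X ⊆ I.machines) (hMX : I.matchedMachines M ⊆ X)
    (hcov : ∀ u ∈ I.criticalJobs M, ∃ w ∈ X \ I.matchedMachines M, u ∈ I.cover M w) :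
    I.IsRobust X := by
  classical
  obtain ⟨m, hm, hMm⟩ := hM.exists_assignment
  have hmX : ∀ u ∈ I.jobs, m u ∈ X := fun u hu =>
    hMX ((mem_matchedMachines_iff hM hm hMm).2 ⟨u, hu, rfl⟩)
  refine ⟨hX, fun f hf =>
    (exists_matching_scenarioGraph_iff (I.vulnerable_subset hf)).2 ?_⟩
  by_cases hfm : ∃ u ∈ I.jobs, m u = f
  · obtain ⟨u, hu, rfl⟩ := hfm
    obtain ⟨w, hwX, huw⟩ := hcov u (Finset.mem_filter.2 ⟨hu, m u, hf, (hMm u hu _).2 rfl⟩)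
    rw [Finset.mem_sdiff, mem_matchedMachines_iff hM hm hMm] at hwX
    have hw : ∀ v ∈ I.jobs, m v ≠ w := fun v hv h => hwX.2 ⟨v, hv, h⟩
    obtain ⟨l, hl⟩ := (mem_cover_iff hM hm hMm (hX hwX.1) hw).1 huw
    obtain ⟨g, hg, hfree, hrange, -⟩ := hl.exists_switch hm hw
    refine ⟨g, hg, fun v hv => ⟨?_, hfree v hv⟩⟩
    rcases hrange v hv with h | ⟨x, hx, h⟩
    · exact h ▸ hwX.1
    · exact h ▸ hmX x hx
  · exact ⟨m, hm, fun u hu => ⟨hmX u hu, fun h => hfm ⟨u, hu, h⟩⟩⟩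

theorem card_matchedMachines {M : I.graph.Subgraph} (hM : I.IsJobPerfectMatching M) :
    (I.matchedMachines M).card = I.jobs.card := by
  obtain ⟨m, hm, hMm⟩ := hM.exists_assignment
  rw [matchedMachines_eq_image hM hm hMm, Finset.card_image_of_injOn hm.injOn]

theorem Run.machines_subset {M : I.graph.Subgraph} {k p : ℕ} {X C : Finset V}
    (h : I.Run M k p X C) : I.matchedMachines M ⊆ X ∧ X ⊆ I.machines := by
  induction h with
  | init => exact ⟨subset_rfl, fun _ h => by classical exact (Finset.mem_filter.1 h).1⟩
  | step _ _ hw ih =>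
    exact ⟨ih.1.trans (Finset.subset_insert _ _),
      Finset.insert_subset (Finset.mem_sdiff.1 hw.1).1 ih.2⟩

theorem Run.card_machines {M : I.graph.Subgraph} {k p : ℕ} {X C : Finset V}
    (h : I.Run M k p X C) : X.card = (I.matchedMachines M).card + k := by
  induction h with
  | init => rfl
  | step _ _ hw ih =>
    rw [Finset.card_insert_of_notMem (Finset.mem_sdiff.1 hw.1).2, ih, add_assoc]

/-- The uncovered jobs are the critical jobs covered by none of the added machines. -/
theorem Run.mem_uncovered_iff {M : I.graph.Subgraph} {k p : ℕ} {X C : Finset V}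
    (h : I.Run M k p X C) (u : V) :
    u ∈ C ↔ u ∈ I.criticalJobs M ∧ ∀ w ∈ X \ I.matchedMachines M, u ∉ I.cover M w := by
  induction h with
  | init => simp
  | @step k p X C w hrun _ hw ih =>
    have hwM : w ∉ I.matchedMachines M := fun h =>
      (Finset.mem_sdiff.1 hw.1).2 (hrun.machines_subset.1 h)
    rw [Finset.mem_sdiff, ih, Finset.insert_sdiff_of_notMem _ hwM, Finset.forall_mem_insert]
    tauto

theorem Run.exists_cover {M : I.graph.Subgraph} (hfeas : I.IsFeasible)
    (hM : I.IsJobPerfectMatching M) {k p : ℕ} {X C : Finset V} (h : I.Run M k p X C)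
    (hC : C.Nonempty) : ∃ w ∈ I.machines \ X, 1 ≤ (I.cover M w ∩ C).card := by
  obtain ⟨u, hu⟩ := hC
  obtain ⟨hcrit, hunc⟩ := (h.mem_uncovered_iff u).1 hu
  obtain ⟨w, hw, huw⟩ := exists_mem_cover hfeas hM hcrit
  rw [Finset.mem_sdiff] at hw
  exact ⟨w, Finset.mem_sdiff.2 ⟨hw.1, fun hX => hunc w (Finset.mem_sdiff.2 ⟨hX, hw.2⟩) huw⟩,
    Finset.card_pos.2 ⟨u, Finset.mem_inter.2 ⟨huw, hu⟩⟩⟩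

theorem Run.exists_greedyChoice {M : I.graph.Subgraph} (hfeas : I.IsFeasible)
    (hM : I.IsJobPerfectMatching M) {k p : ℕ} {X C : Finset V} (h : I.Run M k p X C)
    (hC : C.Nonempty) : ∃ w, I.IsGreedyChoice M X C w := by
  obtain ⟨w, hw, -⟩ := h.exists_cover hfeas hM hC
  obtain ⟨v, hv, hmax⟩ := Finset.exists_max_image (I.machines \ X)
    (fun w => (I.cover M w ∩ C).card) ⟨w, hw⟩
  exact ⟨v, hv, hmax⟩

/-- Of greedy maximality, only the coverage of at least one job is needed here. -/
theorem Run.counters_le {M : I.graph.Subgraph} (hfeas : I.IsFeasible)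
    (hM : I.IsJobPerfectMatching M) {k p : ℕ} {X C : Finset V} (h : I.Run M k p X C) :
    2 * k + p + 2 * C.card ≤ 2 * (I.criticalJobs M).card := by
  induction h with
  | init => simp
  | @step k p X C w hrun hC hw ih =>
    obtain ⟨w', hw', hpos⟩ := hrun.exists_cover hfeas hM hC
    have hle := hw.2 w' hw'
    have hcard := Finset.card_sdiff_add_card_inter C (I.cover M w)
    rw [Finset.inter_comm] at hcard
    split_ifs <;> omega

end Greedy

end CardVRAP

theorem mainTheorem6 {V : Type*} [DecidableEq V] (I : CardVRAP V)
    (hvul : I.vulnerable.Nonempty) (hfeas : I.IsFeasible) :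
    -- the first step of the algorithm can be carried out
    (∃ M : I.graph.Subgraph, I.IsJobPerfectMatching M) ∧
    ∀ M : I.graph.Subgraph, I.IsJobPerfectMatching M →
      -- no execution gets stuck or makes more than `|U|` iterations
      (∀ (k p : ℕ) (X C : Finset V), I.Run M k p X C →
        k ≤ I.jobs.card ∧ (C.Nonempty → ∃ w : V, I.IsGreedyChoice M X C w)) ∧
      -- every output is feasible, with the claimed bounds
      (∀ (k p : ℕ) (X : Finset V), I.Run M k p X ∅ →
        I.IsRobust X ∧
        (X.card : ℝ) ≤ 2 * (I.jobs.card : ℝ) - (p : ℝ) / 2 ∧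
        ∀ OPT : Finset V, I.IsOptimal OPT →
          I.jobs.card ≤ OPT.card ∧ X.card ≤ 2 * OPT.card) := by
  refine ⟨?_, fun M hM => ⟨fun k p X C h => ⟨?_, h.exists_greedyChoice hfeas hM⟩,
    fun k p X h => ?_⟩⟩
  · obtain ⟨X, hX⟩ := hfeas
    obtain ⟨f, hf⟩ := hvul
    obtain ⟨M, hM, -⟩ := hX.2 f hf
    exact ⟨M, hM⟩
  · have h₁ := h.counters_le hfeas hM
    have h₂ := CardVRAP.card_criticalJobs_le M
    omega
  · have h₁ := h.counters_le hfeas hM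
    have h₂ := CardVRAP.card_criticalJobs_le M
    have h₃ := h.card_machines
    rw [CardVRAP.card_matchedMachines hM] at h₃
    rw [Finset.card_empty] at h₁
    have hX : 2 * X.card + p ≤ 4 * I.jobs.card := by omega
    refine ⟨CardVRAP.isRobust_of_cover hM h.machines_subset.2 h.machines_subset.1
      fun u hu => ?_, ?_, fun OPT hOPT => ?_⟩
    · by_contra hcov
      push Not at hcov
      exact Finset.notMem_empty u ((h.mem_uncovered_iff u).2 ⟨hu, hcov⟩)
    · have hX' : 2 * (X.card : ℝ) + p ≤ 4 * I.jobs.card := by exact_mod_cast hX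
      linarith
    · have := hOPT.1.card_jobs_le hvul
      exact ⟨this, by omega⟩
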